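/- Let $F=(F_s)_{s\ge 0}$ be a continuous composition semigroup of non-constant probability generating functions (pgfs) on $|z|\le 1$: $F_s\circ F_t=F_{s+t}$, $\lim_{s\to0}F_s=F_0=I$ with $I(z)=z$, $F_t\ne I$ for $t>0$, and $F_1'(1)=e^{-1}$. An $F$-branching process is a continuous-time Markov branching process $Z=\{Z(s),\,s\ge0\}$ with right-continuous paths, $Z(0)=1$ a.s. and $\mathbb E z^{Z(s)}=F_s(z)$, that is, $\mathbb E[z^{Z(s+t)}\mid Z(r),r\le s]=F_t(z)^{Z(s)}$. For an $\mathbb N_0$-valued process $X=\{X(t),\,t\ge0\}$ and a $(0,1)$-valued random variable $A$, define pathwise $$A\odot_F X(t)=\sum_{i=1}^{X(t)}Z_i(-\log A),\qquad t\ge 0,$$ where $Z_1,Z_2,\dots$ are independent $F$-branching processes, independent of $X$, and $A$ is independent of $(X,Z_1,Z_2,\dots)$. The process $X$ is called $F$-multifractal if for some $T>0$ and every $\lambda\in(0,1)$ there is a $(0,1)$-valued random variable $M(\lambda)$, independent of $X$, such that $\{X(\lambda t)\}_{t\in(0,T]}\overset{d}{=}\{M(\lambda)\odot_F X(t)\}_{t\in(0,T]}$,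 where $\overset{d}{=}$ denotes equality of finite-dimensional distributions. Theorem. Let $Y=\{Y(t),\,t\ge0\}$ be an $\mathbb R_+$-valued nondecreasing process that is multifractal in the classical sense with $(0,1)$-valued factors: there is $T>0$ such that for every $\lambda\in(0,1)$ there is a random variable $M(\lambda)$, independent of $Y$ and a.s. $(0,1)$-valued, with $\{Y(\lambda t)\}_{t\in(0,T]}\overset{d}{=}\{M(\lambda)Y(t)\}_{t\in(0,T]}$. Let $G$ be a pgf with $G(0)=0$ and $1-G(F_t(z))=e^{-t}(1-G(z))$ for all $t>0$ and $0\le z\le1$, and let $N(t)=W_1+\dots+W_{N_1(t)}$ be a compound Poisson process, independent of $Y$, where $N_1$ is a unit rate Poisson process (with right-continuous paths) and $W_1,W_2,\dots$ are independent random variables with pgf $G$, independent of $N_1$. Then the $\mathbb N_0$-valued process $X(t)=N(Y(t))$, $t\ge 0$, is $F$-multifractal; more precisely $$\{X(\lambda t)\}_{t\in(0,T]}\overset{d}{=}\{M(\lambda)\odot_F X(t)\}_{t\in(0,T]},\qquad \lambda\in(0,1),$$ with the same $T$ and with $M(\lambda)$ having the same distribution as the factor for $Y$ (taken independent of $X$).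 -/

import Mathlib

open MeasureTheory ProbabilityTheory Filter Topology
open scoped NNReal ENNReal

universe u v

/-- The probability generating function `P(z) = ∑ₖ zᵏ μ{k}` of a law `μ` on `ℕ`, for `|z| ≤ 1`. -/
noncomputable def pgf (μ : Measure ℕ) (z : ℝ) : ℝ := ∑' k : ℕ, z ^ k * μ.real {k}

/-- `f` is, on `|z| ≤ 1`, the probability generating function of some law on `ℕ`. -/
def IsPGF (f : ℝ → ℝ) : Prop :=
  ∃ μ : Measure ℕ, IsProbabilityMeasure μ ∧ ∀ z : ℝ, |z| ≤ 1 → f z = pgf μ z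

/-- A continuous composition semigroup of non-constant probability generating functions with
`F_t ≠ I` for `t > 0` and `F_1'(1) = e⁻¹`. -/
structure IsPGFSemigroup (F : ℝ≥0 → ℝ → ℝ) : Prop where
  isPGF : ∀ s, IsPGF (F s)
  nonconstant : ∀ s, ¬ ∃ c : ℝ, ∀ z : ℝ, |z| ≤ 1 → F s z = c
  comp : ∀ s t : ℝ≥0, ∀ z : ℝ, |z| ≤ 1 → F s (F t z) = F (s + t) z
  zero : ∀ z : ℝ, |z| ≤ 1 → F 0 z = z
  continuous_zero : ∀ z : ℝ, |z| ≤ 1 → Tendsto (fun s => F s z) (𝓝[>] 0) (𝓝 z)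
  ne_id : ∀ t : ℝ≥0, 0 < t → ∃ z : ℝ, |z| ≤ 1 ∧ F t z ≠ z
  deriv_one : HasDerivWithinAt (F 1) (Real.exp (-1)) (Set.Icc (-1) 1) 1

/-- The functional equation `1 - G(F_t(z)) = e⁻ᵗ (1 - G(z))`, `G(0) = 0`, relating the semigroup `F`
and the jump generating function `G`. -/
def IsRelated (F : ℝ≥0 → ℝ → ℝ) (G : ℝ → ℝ) : Prop :=
  G 0 = 0 ∧ ∀ t : ℝ≥0, 0 < t → ∀ z : ℝ, 0 ≤ z → z ≤ 1 →
    1 - G (F t z) = Real.exp (-(t : ℝ)) * (1 - G z)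

section Processes

variable {Ω : Type u} [MeasurableSpace Ω]

/-- An `F`-branching process: an `ℕ`-valued process with right-continuous paths, started from one
individual, which is Markov with the branching transition law: given the past up to time `s`,
the value at time `s + t` has generating function `F_t(z)` to the power `Z(s)`. -/
structure IsFBranching (F : ℝ≥0 → ℝ → ℝ) (P : Measure Ω) (Z : ℝ≥0 → Ω → ℕ) : Prop where
  measurable : ∀ s, Measurable (Z s)
  rightCont : ∀ ω t, ContinuousWithinAt (fun s => Z s ω) (Set.Ici t) t
  init : ∀ᵐ ω ∂P, Z 0 ω = 1
  pgf_eq : ∀ s : ℝ≥0, ∀ z : ℝ, |z| ≤ 1 → pgf (P.map (Z s)) z = F s z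
  markov : ∀ s t : ℝ≥0, ∀ z : ℝ, |z| ≤ 1 →
    P[fun ω => z ^ Z (s + t) ω | ⨆ r : Set.Iic s, MeasurableSpace.comap (Z r) ⊤]
      =ᵐ[P] fun ω => F t z ^ Z s ω

/-- The data of a multiplication `A ⊙_F X`: `Z 0, Z 1, …` are independent `F`-branching processes,
independent of the process `X`, and `A` is a `(0,1)`-valued random variable independent of `X`
and the `Z i` (jointly). -/
structure IsThinningSetup (F : ℝ≥0 → ℝ → ℝ) (P : Measure Ω) (X : ℝ≥0 → Ω → ℕ) (A : Ω → ℝ≥0)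
    (Z : ℕ → ℝ≥0 → Ω → ℕ) : Prop where
  measurable_X : ∀ t, Measurable (X t)
  measurable_A : Measurable A
  mem_Ioo : ∀ᵐ ω ∂P, A ω ∈ Set.Ioo 0 1
  branching : ∀ i, IsFBranching F P (Z i)
  indep_Z : iIndepFun (fun i ω s => Z i s ω) P
  indep_X : IndepFun (fun ω t => X t ω) (fun ω i s => Z i s ω) P
  indep_A : IndepFun A (fun ω => ((fun t => X t ω), fun i s => Z i s ω)) P

/-- The pathwise multiplication `A ⊙_F X(t) = T_{X(t)}(-log A)` with
`T_n(s) = Z_1(s) + ⋯ + Z_n(s)`; the same `Z` and `A` serve all times `t`. -/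
noncomputable def thin (Z : ℕ → ℝ≥0 → Ω → ℕ) (A : Ω → ℝ≥0) (X : ℝ≥0 → Ω → ℕ) : ℝ≥0 → Ω → ℕ :=
  fun t ω => ∑ i ∈ Finset.range (X t ω), Z i (-Real.log (A ω)).toNNReal ω

/-- Equality of the finite-dimensional distributions over the time set `S` of two processes,
possibly living on different probability spaces. -/
def EqFDDOn {Ω' : Type v} [MeasurableSpace Ω'] {E : Type*} [MeasurableSpace E] (S : Set ℝ≥0)
    (P : Measure Ω) (X : ℝ≥0 → Ω → E) (P' : Measure Ω') (X' : ℝ≥0 → Ω' → E) : Prop :=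
  ∀ I : Finset ℝ≥0, (I : Set ℝ≥0) ⊆ S →
    IdentDistrib (fun ω (t : I) => X t ω) (fun ω (t : I) => X' t ω) P P'

/-- Classical multifractality of an `ℝ₊`-valued process `Y` on `(0,T]`, with `m λ` the law of the
positive factor `M(λ)`: `{Y(λt)} =ᵈ {M(λ) Y(t)}` on `(0,T]`, for `M(λ)` independent of `Y`.
The independent factor is realised as the first coordinate of the product space. -/
def IsMultifractalWith (P : Measure Ω) (Y : ℝ≥0 → Ω → ℝ≥0) (T : ℝ≥0)
    (m : ℝ≥0 → Measure ℝ≥0) : Prop :=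
  (∀ t, Measurable (Y t)) ∧ ∀ l : ℝ≥0, 0 < l → l < 1 →
    IsProbabilityMeasure (m l) ∧ m l {0} = 0 ∧
      EqFDDOn (Set.Ioc 0 T) P (fun t ω => Y (l * t) ω)
        ((m l).prod P) (fun t p => p.1 * Y t p.2)

/-- `F`-multifractality of an `ℕ`-valued process `X` on `(0,T]`, with `m λ` the law of the
`(0,1)`-valued factor `M(λ)`: `{X(λt)} =ᵈ {M(λ) ⊙_F X(t)}` on `(0,T]`.
The right-hand side is formed from any copy `X'` of `X`, factor `A` with law `m λ` and independent
`F`-branching processes `Z i` that satisfy the independence requirements; in particular `X'` may be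
`X` itself when its probability space carries such `A` and `Z i`. -/
def IsFMultifractalWith (F : ℝ≥0 → ℝ → ℝ) (P : Measure Ω) (X : ℝ≥0 → Ω → ℕ) (T : ℝ≥0)
    (m : ℝ≥0 → Measure ℝ≥0) : Prop :=
  (∀ t, Measurable (X t)) ∧ ∀ l : ℝ≥0, 0 < l → l < 1 →
    IsProbabilityMeasure (m l) ∧ m l (Set.Ioo 0 1) = 1 ∧
      ∀ (Ω' : Type v) [MeasurableSpace Ω'] (P' : Measure Ω') [IsProbabilityMeasure P']
        (X' : ℝ≥0 → Ω' → ℕ) (A : Ω' → ℝ≥0) (Z : ℕ → ℝ≥0 → Ω' → ℕ),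
        IsThinningSetup F P' X' A Z → HasLaw A (m l) P' → EqFDDOn Set.univ P X P' X' →
          EqFDDOn (Set.Ioc 0 T) P (fun t ω => X (l * t) ω) P' (thin Z A X')

/-- `X` is `F`-multifractal: for some `T > 0` and every `λ ∈ (0,1)` there is a `(0,1)`-valued
factor `M(λ)`, independent of `X`, with `{X(λt)} =ᵈ {M(λ) ⊙_F X(t)}` on `(0,T]`. -/
def IsFMultifractal (F : ℝ≥0 → ℝ → ℝ) (P : Measure Ω) (X : ℝ≥0 → Ω → ℕ) : Prop :=
  ∃ T : ℝ≥0, 0 < T ∧ ∃ m : ℝ≥0 → Measure ℝ≥0, IsFMultifractalWith.{u, v} F P X T m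

/-- A unit rate Poisson process: right-continuous nondecreasing paths from `0`, independent
increments, and the increment over `[s,t]` Poisson with mean `t - s`. -/
structure IsUnitPoissonProcess (P : Measure Ω) (N : ℝ≥0 → Ω → ℕ) : Prop where
  measurable : ∀ t, Measurable (N t)
  init : ∀ᵐ ω ∂P, N 0 ω = 0
  mono : ∀ ω, Monotone (fun t => N t ω)
  rightCont : ∀ ω t, ContinuousWithinAt (fun s => N s ω) (Set.Ici t) t
  indepIncrements : HasIndepIncrements N P
  increments : ∀ s t : ℝ≥0, s ≤ t → HasLaw (fun ω => N t ω - N s ω) (poissonMeasure (t - s)) P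

/-- A compound Poisson process of rate `1` with jump generating function `G`:
`N(t) = W_1 + ⋯ + W_{N₁(t)}`, with `N₁` a unit rate Poisson process and `W_i` independent random
variables with generating function `G`, independent of `N₁`. -/
def IsCompoundPoisson (G : ℝ → ℝ) (P : Measure Ω) (N : ℝ≥0 → Ω → ℕ) : Prop :=
  ∃ (N₁ : ℝ≥0 → Ω → ℕ) (W : ℕ → Ω → ℕ),
    IsUnitPoissonProcess P N₁ ∧ (∀ i, Measurable (W i)) ∧
    (∀ i, ∀ z : ℝ, |z| ≤ 1 → pgf (P.map (W i)) z = G z) ∧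
    iIndepFun W P ∧ IndepFun (fun ω t => N₁ t ω) (fun ω i => W i ω) P ∧
    ∀ t ω, N t ω = ∑ i ∈ Finset.range (N₁ t ω), W i ω

end Processes

/-!
The law of a random vector of counts is determined by its joint generating function on `[0,1]^I`, so
it suffices to compare the joint generating functions of both sides at finitely many times.

The heart of the matter concerns a compound Poisson process `N` at deterministic times. A monomial
in the values of a nondecreasing sequence is a monomial in its increments, and the increments
of `N` over intervals of lengths `δⱼ` have joint generating function `∏ⱼ exp (-δⱼ (1 - G wⱼ))`. Replacing each
unit of `N` by an independent branching process at age `s` replaces `wⱼ` by `F_s wⱼ`; since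
`1 - G (F_s w) = e⁻ˢ (1 - G w)`, this has the same effect as replacing each `δⱼ` by `e⁻ˢ δⱼ`. Hence
thinning `N` at age `-log a` is the same, in joint law, as running it at the times `a y` instead
of `y` (`integral_multiPow_thinning_compoundPoisson`).

What remains is to freeze the random quantities. The process `N` is evaluated at the independent
random times `Y t`, and the branching processes at the independent random age `-log A`; evaluation
of a path at a time is not measurable on the product space of all paths, so both are handled by
approximating the time from above on a grid and using right continuity
(`integral_comp_eq_integral_integral_of_gridAbove`). With `Φ y` the joint generating function of `N` at
times `y`, this gives `E Φ(M Y)` for the thinned process and `E Φ(Y(λ ·))` for the time-scaled one, and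
these agree by the multifractality of `Y`.
-/

/-! ### Joint generating functions -/

/-- The monomial `∏ᵢ zᵢ ^ nᵢ` in finitely many variables. Its expectation at a random `n` is the joint
generating function of `n`. -/
noncomputable def multiPow {ι : Type*} [Fintype ι] (z : ι → ℝ) (n : ι → ℕ) : ℝ := ∏ i, z i ^ n i

section MultiPow

variable {ι : Type*} [Fintype ι]

lemma multiPow_mem_Icc {z : ι → ℝ} (hz : ∀ i, z i ∈ Set.Icc (0 : ℝ) 1) (n : ι → ℕ) :
    multiPow z n ∈ Set.Icc (0 : ℝ) 1 :=
  ⟨Finset.prod_nonneg fun i _ => pow_nonneg (hz i).1 _,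
    Finset.prod_le_one (fun i _ => pow_nonneg (hz i).1 _) fun i _ => pow_le_one₀ (hz i).1 (hz i).2⟩

lemma multiPow_mul (z w : ι → ℝ) (n : ι → ℕ) :
    multiPow (z * w) n = multiPow z n * multiPow w n := by
  simp [multiPow, mul_pow, Finset.prod_mul_distrib]

lemma integrable_of_mem_Icc {Ω : Type*} [MeasurableSpace Ω] {P : Measure Ω} [IsFiniteMeasure P]
    {f : Ω → ℝ} (hf : AEStronglyMeasurable f P) (h : ∀ ω, f ω ∈ Set.Icc (0 : ℝ) 1) :
    Integrable f P :=
  Integrable.of_bound hf 1 (ae_of_all _ fun ω => by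
    rw [Real.norm_of_nonneg (h ω).1]; exact (h ω).2)

lemma integral_mem_Icc {Ω : Type*} [MeasurableSpace Ω] {P : Measure Ω} [IsProbabilityMeasure P]
    {f : Ω → ℝ} (h : ∀ ω, f ω ∈ Set.Icc (0 : ℝ) 1) : ∫ ω, f ω ∂P ∈ Set.Icc (0 : ℝ) 1 := by
  refine ⟨integral_nonneg fun ω => (h ω).1, ?_⟩
  have := norm_integral_le_of_norm_le_const (μ := P) (f := f) (C := 1) (ae_of_all _ fun ω => by
    rw [Real.norm_of_nonneg (h ω).1]; exact (h ω).2)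
  simp only [probReal_univ, mul_one] at this
  exact (le_abs_self _).trans this

/-- A law on `ι → ℕ` is determined by its joint generating function on `[0,1]^ι`: the monomials
`n ↦ ∏ᵢ zᵢ ^ nᵢ` are closed under products and separate points. -/
lemma measure_ext_of_multiPow {μ ν : Measure (ι → ℕ)} [IsFiniteMeasure μ]
    [IsFiniteMeasure ν]
    (h : ∀ z : ι → ℝ, (∀ i, z i ∈ Set.Icc (0 : ℝ) 1) →
      ∫ n, multiPow z n ∂μ = ∫ n, multiPow z n ∂ν) : μ = ν := by
  classical
  let mono (z : ι → ℝ) (hz : ∀ i, z i ∈ Set.Icc (0 : ℝ) 1) :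
      BoundedContinuousFunction (ι → ℕ) ℝ :=
    BoundedContinuousFunction.ofNormedAddCommGroup (multiPow z) continuous_of_discreteTopology 1
      fun n => by
        rw [Real.norm_of_nonneg (multiPow_mem_Icc hz n).1]; exact (multiPow_mem_Icc hz n).2
  let S : Submonoid (BoundedContinuousFunction (ι → ℕ) ℝ) :=
    { carrier := {g | ∃ z hz, g = mono z hz}
      mul_mem' := by
        rintro _ _ ⟨z, hz, rfl⟩ ⟨w, hw, rfl⟩
        refine ⟨z * w, fun i => ⟨mul_nonneg (hz i).1 (hw i).1,
          mul_le_one₀ (hz i).2 (hw i).1 (hw i).2⟩, ?_⟩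
        ext n
        exact (multiPow_mul z w n).symm
      one_mem' := ⟨fun _ => 1, fun _ => by simp, by
        ext n
        exact (by simp [multiPow] : (1 : ℝ) = multiPow (fun _ => 1) n)⟩ }
  have hstar : star (S : Set (BoundedContinuousFunction (ι → ℕ) ℝ)) = S := by
    ext g
    rw [Set.mem_star, show star g = g from by ext; simp]
  refine ext_of_forall_mem_subalgebra_integral_eq_of_polish (𝕜 := ℝ)
    (A := StarAlgebra.adjoin ℝ (S : Set (BoundedContinuousFunction (ι → ℕ) ℝ))) ?_ ?_
  · intro a b hab
    obtain ⟨i, hi⟩ := Function.ne_iff.1 hab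
    have hz : ∀ j, (fun j => if j = i then (1 / 2 : ℝ) else 1) j ∈ Set.Icc (0 : ℝ) 1 := by
      intro j
      dsimp only
      split_ifs <;> norm_num
    refine ⟨_, ⟨_, ⟨mono _ hz, StarAlgebra.subset_adjoin ℝ _ ⟨_, hz, rfl⟩, rfl⟩, rfl⟩, ?_⟩
    change multiPow _ a ≠ multiPow _ b
    simp only [multiPow, ite_pow, one_pow, Finset.prod_ite_eq', Finset.mem_univ, if_true]
    intro h
    exact hi (pow_right_injective₀ (by norm_num) (by norm_num) h)
  · intro g hg
    have hg' : g ∈ Submodule.span ℝ (S : Set (BoundedContinuousFunction (ι → ℕ) ℝ)) := by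
      have := StarAlgebra.adjoin_eq_span (R := ℝ)
        (S : Set (BoundedContinuousFunction (ι → ℕ) ℝ))
      rw [hstar, Set.union_self, Submonoid.closure_eq] at this
      rw [← this]
      exact hg
    clear hg
    induction hg' using Submodule.span_induction with
    | mem x hx =>
      obtain ⟨z, hz, rfl⟩ := hx
      exact h z hz
    | zero => simp
    | add x y _ _ hx hy =>
      simp only [BoundedContinuousFunction.coe_add, Pi.add_apply]
      rw [integral_add (x.integrable μ) (y.integrable μ),
        integral_add (x.integrable ν) (y.integrable ν), hx, hy]
    | smul a x _ hx =>
      simp only [BoundedContinuousFunction.coe_smul, integral_smul, hx]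

lemma integral_pow_eq_pgf {Ω : Type*} [MeasurableSpace Ω] {P : Measure Ω} [IsProbabilityMeasure P]
    {X : Ω → ℕ} (hX : Measurable X) {z : ℝ} (hz : z ∈ Set.Icc (0 : ℝ) 1) :
    ∫ ω, z ^ X ω ∂P = pgf (P.map X) z := by
  have := Measure.isProbabilityMeasure_map (μ := P) hX.aemeasurable
  rw [← integral_map (f := fun k : ℕ => z ^ k) hX.aemeasurable (by fun_prop),
    integral_countable (integrable_of_mem_Icc (by fun_prop) fun k =>
      ⟨pow_nonneg hz.1 k, pow_le_one₀ hz.1 hz.2⟩)]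
  simp [pgf, mul_comm]

lemma integral_pow_poissonMeasure (r : ℝ≥0) (z : ℝ) :
    ∫ k, z ^ k ∂poissonMeasure r = Real.exp (-(r * (1 - z))) := by
  have h := (NormedSpace.expSeries_div_hasSum_exp ((r : ℝ) * z)).mul_left (Real.exp (-r))
  rw [integral_poissonMeasure]
  rw [← Real.exp_eq_exp_ℝ, ← Real.exp_add] at h
  rw [show -((r : ℝ) * (1 - z)) = -r + r * z by ring, ← h.tsum_eq]
  refine tsum_congr fun n => ?_
  rw [smul_eq_mul, mul_pow]
  ring

end MultiPow

/-! ### Summation by parts -/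

/-- The product of the factors from index `j` on. -/
noncomputable def tailProd {k : ℕ} (z : Fin k → ℝ) (j : Fin k) : ℝ := ∏ t, if j ≤ t then z t else 1

lemma tailProd_mem_Icc {k : ℕ} {z : Fin k → ℝ} (hz : ∀ i, z i ∈ Set.Icc (0 : ℝ) 1) (j : Fin k) :
    tailProd z j ∈ Set.Icc (0 : ℝ) 1 := by
  have h : ∀ t, (if j ≤ t then z t else 1) ∈ Set.Icc (0 : ℝ) 1 := fun t => by
    split_ifs
    exacts [hz t, by simp]
  exact ⟨Finset.prod_nonneg fun t _ => (h t).1,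
    Finset.prod_le_one (fun t _ => (h t).1) fun t _ => (h t).2⟩

/-- The increments of a sequence of length `k + 1`. In `ℕ` and `ℝ≥0` the subtraction truncates; the
notion is used for nondecreasing sequences only. -/
def increment {M : Type*} [Sub M] {k : ℕ} (c : Fin (k + 1) → M) (j : Fin k) : M :=
  c j.succ - c j.castSucc

lemma prod_pow_increment (x : ℝ) {k : ℕ} {c : Fin (k + 1) → ℕ} (hc : Monotone c) (h0 : c 0 = 0) :
    ∏ j, x ^ increment c j = x ^ c (Fin.last k) := by
  induction k with
  | zero => simp [h0]
  | succ k ih =>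
    have := ih (c := fun i => c i.castSucc) (fun a b h => hc (by simpa using h)) h0
    rw [Fin.prod_univ_castSucc]
    simp only [increment, ← Fin.succ_castSucc] at this ⊢
    rw [this, ← pow_add, Fin.succ_last]
    congr 1
    exact Nat.add_sub_cancel' (hc (Fin.le_last _))

/-- Summation by parts in exponential form: a monomial in the values of a nondecreasing sequence
is a monomial in its increments. -/
lemma multiPow_succ_eq_multiPow_increment {k : ℕ} (z : Fin k → ℝ) {c : Fin (k + 1) → ℕ}
    (hc : Monotone c) (h0 : c 0 = 0) :
    multiPow z (fun t => c t.succ) = multiPow (tailProd z) (increment c) := by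
  induction k with
  | zero => simp [multiPow]
  | succ k ih =>
    have hc' : Monotone fun i : Fin (k + 1) => c i.castSucc := fun a b h => hc (by simpa using h)
    have h1 := ih (fun i => z i.castSucc) hc' h0
    have h2 := prod_pow_increment (z (Fin.last k)) hc h0
    rw [Fin.prod_univ_castSucc] at h2
    have h3 : ∀ j : Fin k, tailProd z j.castSucc
        = tailProd (fun i => z i.castSucc) j * z (Fin.last k) := fun j => by
      simp [tailProd, Fin.prod_univ_castSucc, Fin.le_last]
    have h4 : tailProd z (Fin.last k) = z (Fin.last k) := by
      simp [tailProd]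
    simp only [multiPow] at h1 ⊢
    rw [Fin.prod_univ_castSucc, Fin.prod_univ_castSucc, h4]
    simp only [h3, mul_pow, Finset.prod_mul_distrib]
    rw [mul_assoc, h2, Fin.succ_last]
    simp only [increment, ← Fin.succ_castSucc] at h1 ⊢
    rw [h1]

/-! ### Random sums of independent terms -/

section RandomSums

variable {Ω : Type*} [MeasurableSpace Ω]

lemma measurable_multiPow_comp {ι : Type*} [Fintype ι] (z : ι → ℝ) {n : Ω → ι → ℕ}
    (hn : Measurable n) : Measurable fun ω => multiPow z (n ω) :=
  (measurable_of_countable (multiPow z)).comp hn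

/-- Independence turned into iterated integration. -/
lemma integral_comp_eq_integral_integral_of_indepFun {P : Measure Ω} [IsProbabilityMeasure P]
    {S D : Type*} [MeasurableSpace S] [MeasurableSpace D] {θ : Ω → S} {η : Ω → D}
    (hθ : Measurable θ) (hη : Measurable η) (h : IndepFun θ η P) {φ : S × D → ℝ}
    (hφ : Measurable φ) (hφ1 : ∀ p, φ p ∈ Set.Icc (0 : ℝ) 1) :
    ∫ ω, φ (θ ω, η ω) ∂P = ∫ ω, ∫ ω', φ (θ ω, η ω') ∂P ∂P := by
  have h1 := (indepFun_iff_map_prod_eq_prod_map_map hθ.aemeasurable hη.aemeasurable).1 h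
  have := Measure.isProbabilityMeasure_map (μ := P) hθ.aemeasurable
  have := Measure.isProbabilityMeasure_map (μ := P) hη.aemeasurable
  rw [← integral_map (hθ.prodMk hη).aemeasurable hφ.aestronglyMeasurable, h1,
    integral_prod _ (integrable_of_mem_Icc hφ.aestronglyMeasurable hφ1),
    integral_map hθ.aemeasurable hφ.stronglyMeasurable.integral_prod_right'.aestronglyMeasurable]
  refine integral_congr_ae (ae_of_all _ fun ω => ?_)
  dsimp only
  exact integral_map hη.aemeasurable (hφ.comp measurable_prodMk_left).aestronglyMeasurable

lemma measurable_randomSum :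
    Measurable fun p : ℕ × (ℕ → ℕ) => ∑ i ∈ Finset.range p.1, p.2 i :=
  measurable_from_prod_countable_right fun n =>
    Finset.measurable_fun_sum (Finset.range n)
      (f := fun i (x : ℕ → ℕ) => x i) fun i _ => measurable_pi_apply i

/-- The sum of a sequence over each of the consecutive blocks `[n₀, n₁), [n₁, n₂), …`. -/
def blockSum {k : ℕ} (x : ℕ → ℕ) (n : Fin (k + 1) → ℕ) (j : Fin k) : ℕ :=
  ∑ i ∈ Finset.Ico (n j.castSucc) (n j.succ), x i

lemma blockSum_eq_increment {k : ℕ} (x : ℕ → ℕ) {n : Fin (k + 1) → ℕ} (hn : Monotone n) :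
    blockSum x n = increment fun t => ∑ i ∈ Finset.range (n t), x i := by
  funext j
  rw [blockSum, increment, ← Finset.sum_range_add_sum_Ico x (hn j.castSucc_le_succ),
    Nat.add_sub_cancel_left]

/-- The blocks are disjoint, so at most one factor of the product differs from `1`. -/
lemma prod_ite_mem_block {k : ℕ} {n : Fin (k + 1) → ℕ} (hn : Monotone n) (v : Fin k → ℝ)
    {f : ℝ → ℝ} (hf : f 1 = 1) (i : ℕ) :
    f (∏ j, if i ∈ Finset.Ico (n j.castSucc) (n j.succ) then v j else 1)
      = ∏ j, if i ∈ Finset.Ico (n j.castSucc) (n j.succ) then f (v j) else 1 := by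
  by_cases h : ∃ j : Fin k, i ∈ Finset.Ico (n j.castSucc) (n j.succ)
  · obtain ⟨j, hj⟩ := h
    have huniq : ∀ b : Fin k, b ≠ j → i ∉ Finset.Ico (n b.castSucc) (n b.succ) := by
      intro b hb hi
      simp only [Finset.mem_Ico] at hi hj
      rcases lt_or_gt_of_ne hb with hlt | hlt
      · have := hn (show b.succ ≤ j.castSucc from hlt)
        omega
      · have := hn (show j.succ ≤ b.castSucc from hlt)
        omega
    rw [Finset.prod_eq_single j (fun b _ hb => if_neg (huniq b hb)) (by simp),
      Finset.prod_eq_single j (fun b _ hb => if_neg (huniq b hb)) (by simp), if_pos hj, if_pos hj]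
  · push Not at h
    rw [Finset.prod_congr rfl fun j _ => if_neg (h j), Finset.prod_congr rfl fun j _ => if_neg (h j)]
    simp [hf]

/-- The joint generating function of the block sums of an i.i.d. sequence with generating
function `f`. -/
lemma integral_multiPow_blockSum {P : Measure Ω} [IsProbabilityMeasure P] {ξ : ℕ → Ω → ℕ}
    (hξ : ∀ i, Measurable (ξ i)) (hind : iIndepFun ξ P) {f : ℝ → ℝ}
    (hf : ∀ i, ∀ z ∈ Set.Icc (0 : ℝ) 1, ∫ ω, z ^ ξ i ω ∂P = f z) {k : ℕ}
    {n : Fin (k + 1) → ℕ} (hn : Monotone n) {v : Fin k → ℝ}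
    (hv : ∀ j, v j ∈ Set.Icc (0 : ℝ) 1) :
    ∫ ω, multiPow v (blockSum (fun i => ξ i ω) n) ∂P = multiPow (fun j => f (v j)) (increment n) := by
  -- `g i` is the weight carried by the `i`-th term, that is, by its block.
  set g : ℕ → ℝ := fun i => ∏ j, if i ∈ Finset.Ico (n j.castSucc) (n j.succ) then v j else 1
  set M := n (Fin.last k)
  have hg : ∀ i, g i ∈ Set.Icc (0 : ℝ) 1 := by
    intro i
    have h : ∀ j, (if i ∈ Finset.Ico (n j.castSucc) (n j.succ) then v j else 1)
        ∈ Set.Icc (0 : ℝ) 1 := fun j => by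
      split_ifs
      exacts [hv j, by simp]
    exact ⟨Finset.prod_nonneg fun t _ => (h t).1,
      Finset.prod_le_one (fun t _ => (h t).1) fun t _ => (h t).2⟩
  have hsub : ∀ j : Fin k, (Finset.range M).filter
      (fun i => i ∈ Finset.Ico (n j.castSucc) (n j.succ))
        = Finset.Ico (n j.castSucc) (n j.succ) := by
    intro j
    ext i
    have := hn (Fin.le_last j.succ)
    simp only [Finset.mem_filter, Finset.mem_range, Finset.mem_Ico, M]
    omega
  have hf1 : f 1 = 1 := by rw [← hf 0 1 (by simp)]; simp
  have h1 : ∀ ω, multiPow v (blockSum (fun i => ξ i ω) n)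
      = ∏ i : Fin M, g i ^ ξ i ω := by
    intro ω
    rw [Fin.prod_univ_eq_prod_range (fun i => g i ^ ξ i ω) M]
    simp only [g, ← Finset.prod_pow]
    rw [Finset.prod_comm]
    refine Finset.prod_congr rfl fun j _ => ?_
    rw [blockSum, ← Finset.prod_pow_eq_pow_sum, ← hsub j, Finset.prod_filter, hsub j]
    exact Finset.prod_congr rfl fun i _ => by split_ifs <;> simp
  simp_rw [h1]
  have hind' : iIndepFun (fun i : Fin M => ξ i) P := hind.precomp Fin.val_injective
  rw [hind'.integral_fun_prod_comp
    (f := fun (i : Fin M) x => g i ^ x) (fun i => (hξ i).aemeasurable) (fun i => by fun_prop)]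
  simp_rw [hf _ _ (hg _)]
  rw [Fin.prod_univ_eq_prod_range (fun i => f (g i)) M]
  simp only [g, prod_ite_mem_block hn v hf1]
  rw [Finset.prod_comm]
  refine Finset.prod_congr rfl fun j _ => ?_
  rw [← Finset.prod_filter, hsub j]
  simp [increment]

lemma measurable_blockSum {k : ℕ} :
    Measurable fun p : (Fin (k + 1) → ℕ) × (ℕ → ℕ) => blockSum p.2 p.1 :=
  measurable_from_prod_countable_right fun n => measurable_pi_lambda _ fun j =>
    Finset.measurable_fun_sum (Finset.Ico (n j.castSucc) (n j.succ))
      (f := fun i (x : ℕ → ℕ) => x i) fun i _ => measurable_pi_apply i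

/-- The joint generating function of the block sums over random blocks that are independent of
the terms. -/
lemma integral_multiPow_blockSum_of_indepFun {P : Measure Ω} [IsProbabilityMeasure P]
    {ξ : ℕ → Ω → ℕ} (hξ : ∀ i, Measurable (ξ i)) (hind : iIndepFun ξ P) {f : ℝ → ℝ}
    (hf : ∀ i, ∀ z ∈ Set.Icc (0 : ℝ) 1, ∫ ω, z ^ ξ i ω ∂P = f z) {k : ℕ}
    {n : Ω → Fin (k + 1) → ℕ} (hnm : Measurable n) (hn : ∀ ω, Monotone (n ω))
    (hnξ : IndepFun n (fun ω i => ξ i ω) P) {v : Fin k → ℝ}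
    (hv : ∀ j, v j ∈ Set.Icc (0 : ℝ) 1) :
    ∫ ω, multiPow v (blockSum (fun i => ξ i ω) (n ω)) ∂P
      = ∫ ω, multiPow (fun j => f (v j)) (increment (n ω)) ∂P := by
  have h := integral_comp_eq_integral_integral_of_indepFun hnm (measurable_pi_lambda _ hξ) hnξ
    (φ := fun p => multiPow v (blockSum p.2 p.1)) (measurable_multiPow_comp v measurable_blockSum)
    fun p => multiPow_mem_Icc hv _
  rw [h]
  exact integral_congr_ae (ae_of_all _ fun ω => integral_multiPow_blockSum hξ hind hf (hn ω) hv)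

end RandomSums

/-! ### Compound Poisson processes -/

section CompoundPoisson

variable {Ω : Type*} [MeasurableSpace Ω] {P : Measure Ω}

lemma IsUnitPoissonProcess.integral_multiPow_increment {N : ℝ≥0 → Ω → ℕ}
    (hN : IsUnitPoissonProcess P N) {k : ℕ} {u : Fin (k + 1) → ℝ≥0} (hu : Monotone u)
    (v : Fin k → ℝ) :
    ∫ ω, multiPow v (increment fun t => N (u t) ω) ∂P
      = ∏ j, Real.exp (-(increment u j * (1 - v j))) := by
  have h := (hN.indepIncrements k u hu).integral_fun_prod_comp
    (f := fun j x => v j ^ x)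
    (fun j => ((hN.measurable _).sub (hN.measurable _)).aemeasurable) (fun i => by fun_prop)
  simp only [multiPow, increment]
  rw [h]
  refine Finset.prod_congr rfl fun j _ => ?_
  have hl := hN.increments (u j.castSucc) (u j.succ) (hu j.castSucc_le_succ)
  rw [← integral_pow_poissonMeasure, ← hl.map_eq, integral_map hl.aemeasurable (by fun_prop)]

namespace IsCompoundPoisson

variable {G : ℝ → ℝ} {N : ℝ≥0 → Ω → ℕ}

lemma measurable (hN : IsCompoundPoisson G P N) (t : ℝ≥0) : Measurable (N t) := by
  obtain ⟨N₁, W, hN₁, hW, -, -, -, hNW⟩ := hN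
  rw [show N t = fun ω => ∑ i ∈ Finset.range (N₁ t ω), W i ω from funext fun ω => hNW t ω]
  exact measurable_randomSum.comp ((hN₁.measurable t).prodMk (measurable_pi_lambda _ hW))

lemma mono (hN : IsCompoundPoisson G P N) (ω : Ω) : Monotone fun t => N t ω := by
  obtain ⟨N₁, W, hN₁, -, -, -, -, hNW⟩ := hN
  intro s t hst
  simp only [hNW]
  exact Finset.sum_le_sum_of_subset (Finset.range_subset_range.2 (hN₁.mono ω hst))

lemma rightCont (hN : IsCompoundPoisson G P N) (ω : Ω) (t : ℝ≥0) :
    ContinuousWithinAt (fun s => N s ω) (Set.Ici t) t := by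
  obtain ⟨N₁, W, hN₁, -, -, -, -, hNW⟩ := hN
  simp only [hNW]
  exact (continuous_of_discreteTopology
    (f := fun n => ∑ i ∈ Finset.range n, W i ω)).continuousAt.comp_continuousWithinAt
    (hN₁.rightCont ω t)

lemma init (hN : IsCompoundPoisson G P N) : ∀ᵐ ω ∂P, N 0 ω = 0 := by
  obtain ⟨N₁, W, hN₁, -, -, -, -, hNW⟩ := hN
  filter_upwards [hN₁.init] with ω h
  simp [hNW, h]

/-- The increments of a compound Poisson process are independent, with generating functions
`exp (-δ (1 - G))`. -/
lemma integral_multiPow_increment [IsProbabilityMeasure P] (hN : IsCompoundPoisson G P N) {k : ℕ}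
    {u : Fin (k + 1) → ℝ≥0} (hu : Monotone u) {v : Fin k → ℝ}
    (hv : ∀ j, v j ∈ Set.Icc (0 : ℝ) 1) :
    ∫ ω, multiPow v (increment fun t => N (u t) ω) ∂P
      = ∏ j, Real.exp (-(increment u j * (1 - G (v j)))) := by
  obtain ⟨N₁, W, hN₁, hW, hG, hWi, hNWi, hNW⟩ := hN
  have hf : ∀ i, ∀ z ∈ Set.Icc (0 : ℝ) 1, ∫ ω, z ^ W i ω ∂P = G z := fun i z hz => by
    rw [integral_pow_eq_pgf (hW i) hz, hG i z (abs_le.2 ⟨by linarith [hz.1], hz.2⟩)]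
  have hm : ∀ ω, Monotone fun t => N₁ (u t) ω := fun ω a b h => hN₁.mono ω (hu h)
  have hproj : Measurable fun (x : ℝ≥0 → ℕ) (t : Fin (k + 1)) => x (u t) :=
    measurable_pi_lambda _ fun t => measurable_pi_apply _
  rw [← hN₁.integral_multiPow_increment hu, ← integral_multiPow_blockSum_of_indepFun hW hWi hf
    (measurable_pi_lambda _ fun t => hN₁.measurable _) hm (hNWi.comp hproj measurable_id) hv]
  simp only [hNW]
  exact integral_congr_ae (ae_of_all _ fun ω => by
    dsimp only
    rw [blockSum_eq_increment _ (hm ω)])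

end IsCompoundPoisson

end CompoundPoisson

/-! ### Thinning a compound Poisson process -/

section Thinning

variable {Ω Ω' : Type*} [MeasurableSpace Ω] [MeasurableSpace Ω'] {P : Measure Ω} {P' : Measure Ω'}
  [IsProbabilityMeasure P] [IsProbabilityMeasure P'] {G : ℝ → ℝ} {N : ℝ≥0 → Ω → ℕ}

/-- The case of ordered times of `integral_multiPow_thinning_compoundPoisson`. -/
lemma integral_multiPow_thinning_compoundPoisson_of_monotone (hN : IsCompoundPoisson G P N)
    {ξ : ℕ → Ω' → ℕ}
    (hξ : ∀ i, Measurable (ξ i)) (hind : iIndepFun ξ P') {f : ℝ → ℝ}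
    (hf : ∀ i, ∀ z ∈ Set.Icc (0 : ℝ) 1, ∫ ω, z ^ ξ i ω ∂P' = f z) {a : ℝ≥0}
    (hfG : ∀ z ∈ Set.Icc (0 : ℝ) 1, 1 - G (f z) = a * (1 - G z))
    {k : ℕ} {y : Fin k → ℝ≥0} (hy : Monotone y) {z : Fin k → ℝ}
    (hz : ∀ i, z i ∈ Set.Icc (0 : ℝ) 1) :
    ∫ ω, ∫ ω', multiPow z (fun t => ∑ i ∈ Finset.range (N (y t) ω), ξ i ω') ∂P' ∂P
      = ∫ ω, multiPow z (fun t => N (a * y t) ω) ∂P := by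
  set u : Fin (k + 1) → ℝ≥0 := Fin.cons 0 y
  have hu : Monotone u := by
    intro i j hij
    induction i using Fin.cases with
    | zero => simp [u]
    | succ i =>
      induction j using Fin.cases with
      | zero => simp at hij
      | succ j => exact hy (Fin.succ_le_succ_iff.1 hij)
  have hau : Monotone fun t => a * u t := fun i j h => mul_le_mul_right (hu h) a
  set w := tailProd z
  have hw := tailProd_mem_Icc hz
  have hfw : ∀ j, f (w j) ∈ Set.Icc (0 : ℝ) 1 := fun j => by
    rw [← hf 0 _ (hw j)]
    exact integral_mem_Icc fun ω => ⟨pow_nonneg (hw j).1 _, pow_le_one₀ (hw j).1 (hw j).2⟩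
  have hl : ∀ᵐ ω ∂P,
      ∫ ω', multiPow z (fun t => ∑ i ∈ Finset.range (N (y t) ω), ξ i ω') ∂P'
        = multiPow (fun j => f (w j)) (increment fun t => N (u t) ω) := by
    filter_upwards [hN.init] with ω h0
    have hm : Monotone fun t => N (u t) ω := fun i j h => hN.mono ω (hu h)
    rw [← integral_multiPow_blockSum hξ hind hf hm hw]
    refine integral_congr_ae (ae_of_all _ fun ω' => ?_)
    dsimp only
    rw [blockSum_eq_increment _ hm, ← multiPow_succ_eq_multiPow_increment]
    · simp [u]
    · intro i j h
      exact Finset.sum_le_sum_of_subset (Finset.range_subset_range.2 (hm h))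
    · simp [u, h0]
  have hr : ∀ᵐ ω ∂P, multiPow z (fun t => N (a * y t) ω)
      = multiPow w (increment fun t => N (a * u t) ω) := by
    filter_upwards [hN.init] with ω h0
    rw [← multiPow_succ_eq_multiPow_increment]
    · simp [u]
    · exact fun i j h => hN.mono ω (hau h)
    · simp [u, h0]
  rw [integral_congr_ae hl, integral_congr_ae hr, hN.integral_multiPow_increment hu hfw,
    hN.integral_multiPow_increment hau hw]
  refine Finset.prod_congr rfl fun j _ => ?_
  rw [hfG _ (hw j), increment, increment, ← mul_tsub, NNReal.coe_mul]
  ring_nf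

/-- Replacing each unit of a compound Poisson process by an independent random number of units
with generating function `f`, where `1 - G ∘ f = a (1 - G)`, slows the process down by the factor `a`,
jointly at any finite family of times. -/
lemma integral_multiPow_thinning_compoundPoisson (hN : IsCompoundPoisson G P N) {ξ : ℕ → Ω' → ℕ}
    (hξ : ∀ i, Measurable (ξ i)) (hind : iIndepFun ξ P') {f : ℝ → ℝ}
    (hf : ∀ i, ∀ z ∈ Set.Icc (0 : ℝ) 1, ∫ ω, z ^ ξ i ω ∂P' = f z) {a : ℝ≥0}
    (hfG : ∀ z ∈ Set.Icc (0 : ℝ) 1, 1 - G (f z) = a * (1 - G z))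
    {ι : Type*} [Fintype ι] (y : ι → ℝ≥0) {z : ι → ℝ} (hz : ∀ i, z i ∈ Set.Icc (0 : ℝ) 1) :
    ∫ ω, ∫ ω', multiPow z (fun t => ∑ i ∈ Finset.range (N (y t) ω), ξ i ω') ∂P' ∂P
      = ∫ ω, multiPow z (fun t => N (a * y t) ω) ∂P := by
  set e := (Tuple.sort (y ∘ (Fintype.equivFin ι).symm)).trans (Fintype.equivFin ι).symm
  have he : Monotone (y ∘ e) := Tuple.monotone_sort (y ∘ (Fintype.equivFin ι).symm)
  have hp : ∀ n : ι → ℕ, multiPow z n = multiPow (z ∘ e) (n ∘ e) := fun n =>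
    (Equiv.prod_comp e fun i => z i ^ n i).symm
  simp_rw [hp]
  exact integral_multiPow_thinning_compoundPoisson_of_monotone hN hξ hind hf hfG he fun i => hz (e i)

end Thinning

/-! ### Evaluation at independent random times -/

section RandomTimes

/-- The strict upper approximation of `y` in the grid of mesh `1 / (k + 1)`. Strictness matters: right
continuity is used along it. -/
noncomputable def gridAbove (k : ℕ) (y : ℝ≥0) : ℝ≥0 := (⌊(k + 1) * y⌋₊ + 1) / (k + 1)

lemma le_gridAbove (k : ℕ) (y : ℝ≥0) : y ≤ gridAbove k y := by
  rw [gridAbove, le_div_iff₀ (by positivity), mul_comm]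
  exact (Nat.lt_floor_add_one _).le

lemma tendsto_gridAbove (y : ℝ≥0) : Tendsto (fun k => gridAbove k y) atTop (𝓝[≥] y) := by
  refine tendsto_nhdsWithin_iff.2 ⟨?_, Eventually.of_forall fun k => le_gridAbove k y⟩
  have h : Tendsto (fun k : ℕ => y + 1 / ((k : ℝ≥0) + 1)) atTop (𝓝 y) := by
    simpa using tendsto_const_nhds.add (tendsto_one_div_add_atTop_nhds_zero_nat (𝕜 := ℝ≥0))
  refine tendsto_of_tendsto_of_tendsto_of_le_of_le tendsto_const_nhds h
    (fun k => le_gridAbove k y) fun k => ?_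
  rw [gridAbove, div_le_iff₀ (by positivity), add_mul y, one_div,
    inv_mul_cancel₀ (by positivity)]
  gcongr
  rw [mul_comm]
  exact Nat.floor_le (zero_le)

/-- A right continuous integer valued path is constant along the grid approximations, eventually. -/
lemma eventually_eq_gridAbove {x : ℝ≥0 → ℕ} {y : ℝ≥0} (hx : ContinuousWithinAt x (Set.Ici y) y) :
    ∀ᶠ k in atTop, x (gridAbove k y) = x y := by
  have h := hx.tendsto.comp (tendsto_gridAbove y)
  rw [nhds_discrete] at h
  exact tendsto_pure.1 h

variable {Ω : Type*} [MeasurableSpace Ω] {P : Measure Ω} [IsProbabilityMeasure P] {ι : Type*}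
  {D : Type*} [MeasurableSpace D] {η : Ω → D} {φ : (ι → ℝ≥0) → D → ℝ}

lemma measurable_comp_gridAbove [Finite ι] {R : Type*} [MeasurableSpace R]
    {φ : (ι → ℝ≥0) → D → R} (hφ : ∀ s, Measurable (φ s)) {E : Type*} [MeasurableSpace E]
    {θ : E → ι → ℝ≥0} {ζ : E → D} (hθ : Measurable θ) (hζ : Measurable ζ)
    (k : ℕ) : Measurable fun e => φ (fun i => gridAbove k (θ e i)) (ζ e) := by
  have h : Measurable fun q : (ι → ℕ) × D =>
      φ (fun i => ((q.1 i : ℝ≥0) + 1) / (k + 1)) q.2 :=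
    measurable_from_prod_countable_right fun n =>
      hφ fun i => ((n i : ℝ≥0) + 1) / (k + 1)
  have hfl : Measurable fun e => fun i => ⌊((k : ℝ≥0) + 1) * θ e i⌋₊ :=
    measurable_pi_lambda _ fun i => Nat.measurable_floor.comp
      (((measurable_pi_apply i).comp hθ).const_mul _)
  have h2 := h.comp (hfl.prodMk hζ)
  simp only [Function.comp_def] at h2
  simp only [gridAbove]
  exact h2

lemma tendsto_integral_gridAbove (hη : Measurable η) (hφ : ∀ s, Measurable (φ s))
    (hφ1 : ∀ s d, φ s d ∈ Set.Icc (0 : ℝ) 1)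
    (hlim : ∀ s ω, Tendsto (fun k => φ (fun i => gridAbove k (s i)) (η ω)) atTop (𝓝 (φ s (η ω))))
    (s : ι → ℝ≥0) :
    Tendsto (fun k => ∫ ω, φ (fun i => gridAbove k (s i)) (η ω) ∂P) atTop
      (𝓝 (∫ ω, φ s (η ω) ∂P)) :=
  tendsto_integral_of_dominated_convergence (fun _ => 1)
    (fun k => ((hφ _).comp hη).aestronglyMeasurable) (integrable_const _)
    (fun k => ae_of_all _ fun ω => by rw [Real.norm_of_nonneg (hφ1 _ _).1]; exact (hφ1 _ _).2)
    (ae_of_all _ fun ω => hlim s ω)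

lemma measurable_integral_of_gridAbove [Finite ι] (hη : Measurable η) (hφ : ∀ s, Measurable (φ s))
    (hφ1 : ∀ s d, φ s d ∈ Set.Icc (0 : ℝ) 1)
    (hlim : ∀ s ω, Tendsto (fun k => φ (fun i => gridAbove k (s i)) (η ω)) atTop (𝓝 (φ s (η ω)))) :
    Measurable fun s => ∫ ω, φ s (η ω) ∂P := by
  have hlim' := tendsto_pi_nhds.2 (tendsto_integral_gridAbove (P := P) hη hφ hφ1 hlim)
  refine measurable_of_tendsto_metrizable (fun k => ?_) hlim'
  have h : Measurable fun p : (ι → ℝ≥0) × Ω => φ (fun i => gridAbove k (p.1 i)) (η p.2) :=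
    measurable_comp_gridAbove hφ measurable_fst (hη.comp measurable_snd) k
  exact (h.stronglyMeasurable.integral_prod_right' (ν := P)).measurable

/-- Freezing an independent random time. The functional `φ` need not be jointly measurable; it
suffices that it is right continuous in time along the paths of `η`. -/
lemma integral_comp_eq_integral_integral_of_gridAbove [Finite ι] {θ : Ω → ι → ℝ≥0} (hθ : Measurable θ)
    (hη : Measurable η) (hind : IndepFun θ η P) (hφ : ∀ s, Measurable (φ s))
    (hφ1 : ∀ s d, φ s d ∈ Set.Icc (0 : ℝ) 1)
    (hlim : ∀ s ω, Tendsto (fun k => φ (fun i => gridAbove k (s i)) (η ω)) atTop (𝓝 (φ s (η ω)))) :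
    ∫ ω, φ (θ ω) (η ω) ∂P = ∫ ω, ∫ ω', φ (θ ω) (η ω') ∂P ∂P := by
  have h1 : Tendsto (fun k => ∫ ω, φ (fun i => gridAbove k (θ ω i)) (η ω) ∂P) atTop
      (𝓝 (∫ ω, φ (θ ω) (η ω) ∂P)) :=
    tendsto_integral_of_dominated_convergence (fun _ => 1)
      (fun k => (measurable_comp_gridAbove hφ hθ hη k).aestronglyMeasurable)
      (integrable_const _)
      (fun k => ae_of_all _ fun ω => by rw [Real.norm_of_nonneg (hφ1 _ _).1]; exact (hφ1 _ _).2)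
      (ae_of_all _ fun ω => hlim _ ω)
  have h2 : Tendsto (fun k => ∫ ω, ∫ ω', φ (fun i => gridAbove k (θ ω i)) (η ω') ∂P ∂P) atTop
      (𝓝 (∫ ω, ∫ ω', φ (θ ω) (η ω') ∂P ∂P)) := by
    refine tendsto_integral_of_dominated_convergence (fun _ => 1) (fun k => ?_)
      (integrable_const _) (fun k => ae_of_all _ fun ω => ?_)
      (ae_of_all _ fun ω => tendsto_integral_gridAbove hη hφ hφ1 hlim (θ ω))
    · have h : Measurable fun p : Ω × Ω => φ (fun i => gridAbove k (θ p.1 i)) (η p.2) :=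
        measurable_comp_gridAbove hφ (hθ.comp measurable_fst) (hη.comp measurable_snd) k
      exact (h.stronglyMeasurable.integral_prod_right' (ν := P)).aestronglyMeasurable
    · have := integral_mem_Icc (P := P) fun ω' => hφ1 (fun i => gridAbove k (θ ω i)) (η ω')
      rw [Real.norm_of_nonneg this.1]
      exact this.2
  refine tendsto_nhds_unique h1 (h2.congr fun k => ?_)
  exact (integral_comp_eq_integral_integral_of_indepFun hθ hη hind
    (φ := fun p => φ (fun i => gridAbove k (p.1 i)) p.2)
    (measurable_comp_gridAbove hφ measurable_fst measurable_snd k) fun p => hφ1 _ _).symm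

/-- A right continuous measurable process evaluated at a measurable random time is measurable. -/
lemma measurable_eval_of_rightCont {x : ℝ≥0 → Ω → ℕ} (hx : ∀ t, Measurable (x t))
    (hcont : ∀ ω t, ContinuousWithinAt (fun s => x s ω) (Set.Ici t) t) {τ : Ω → ℝ≥0}
    (hτ : Measurable τ) : Measurable fun ω => x (τ ω) ω := by
  have hlim : Tendsto (fun k ω => x (gridAbove k (τ ω)) ω) atTop (𝓝 fun ω => x (τ ω) ω) :=
    tendsto_pi_nhds.2 fun ω => tendsto_nhds_of_eventually_eq (eventually_eq_gridAbove (hcont ω _))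
  refine measurable_of_tendsto_metrizable (fun k => ?_) hlim
  exact measurable_comp_gridAbove (ι := Unit) (φ := fun s ω => x (s ()) ω) (fun s => hx _)
    (θ := fun ω _ => τ ω) (measurable_pi_lambda _ fun _ => hτ) measurable_id k

lemma tendsto_comp_gridAbove {Ω ι : Type*} [Finite ι] {x : ℝ≥0 → Ω → ℕ} {h : (ι → ℕ) → ℝ}
    (hcont : ∀ ω t, ContinuousWithinAt (fun s => x s ω) (Set.Ici t) t) (s : ι → ℝ≥0) (ω : Ω) :
    Tendsto (fun k => h fun i => x (gridAbove k (s i)) ω) atTop (𝓝 (h fun i => x (s i) ω)) := by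
  refine tendsto_nhds_of_eventually_eq ?_
  filter_upwards [eventually_all.2 fun i => eventually_eq_gridAbove (hcont ω (s i))] with k hk
  exact congrArg h (funext hk)

variable {x : ℝ≥0 → Ω → ℕ} {h : (ι → ℕ) → ℝ}

/-- Freezing independent random times in a right continuous integer valued process. -/
lemma integral_eval_eq_integral_integral [Finite ι] (hx : ∀ t, Measurable (x t))
    (hcont : ∀ ω t, ContinuousWithinAt (fun s => x s ω) (Set.Ici t) t) {θ : Ω → ι → ℝ≥0}
    (hθ : Measurable θ) (hind : IndepFun θ (fun ω t => x t ω) P)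
    (hh : ∀ n, h n ∈ Set.Icc (0 : ℝ) 1) :
    ∫ ω, h (fun i => x (θ ω i) ω) ∂P = ∫ ω, ∫ ω', h (fun i => x (θ ω i) ω') ∂P ∂P :=
  integral_comp_eq_integral_integral_of_gridAbove
    (φ := fun (s : ι → ℝ≥0) (d : ℝ≥0 → ℕ) => h fun i => d (s i)) hθ (measurable_pi_lambda _ hx) hind
    (fun _ => (measurable_of_countable h).comp
      (measurable_pi_lambda _ fun _ => measurable_pi_apply _))
    (fun _ _ => hh _) (tendsto_comp_gridAbove hcont)

lemma measurable_integral_eval [Finite ι] (hx : ∀ t, Measurable (x t))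
    (hcont : ∀ ω t, ContinuousWithinAt (fun s => x s ω) (Set.Ici t) t)
    (hh : ∀ n, h n ∈ Set.Icc (0 : ℝ) 1) :
    Measurable fun s : ι → ℝ≥0 => ∫ ω, h (fun i => x (s i) ω) ∂P :=
  measurable_integral_of_gridAbove
    (φ := fun (s : ι → ℝ≥0) (d : ℝ≥0 → ℕ) => h fun i => d (s i)) (measurable_pi_lambda _ hx)
    (fun _ => (measurable_of_countable h).comp
      (measurable_pi_lambda _ fun _ => measurable_pi_apply _))
    (fun _ _ => hh _) (tendsto_comp_gridAbove hcont)

end RandomTimes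

/-! ### The thinned process -/

lemma measurable_multiPow_randomSum {ι : Type*} [Fintype ι] (z : ι → ℝ) :
    Measurable fun p : (ι → ℕ) × (ℕ → ℕ) =>
      multiPow z fun t => ∑ i ∈ Finset.range (p.1 t), p.2 i :=
  measurable_multiPow_comp z <| measurable_pi_lambda _ fun t =>
    measurable_randomSum.comp (g := fun p : ℕ × (ℕ → ℕ) => ∑ i ∈ Finset.range p.1, p.2 i)
      (f := fun p : (ι → ℕ) × (ℕ → ℕ) => (p.1 t, p.2))
      (((measurable_pi_apply t).comp measurable_fst).prodMk measurable_snd)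

namespace IsThinningSetup

variable {Ω : Type*} [MeasurableSpace Ω] {P : Measure Ω} {F : ℝ≥0 → ℝ → ℝ} {X : ℝ≥0 → Ω → ℕ}
  {A : Ω → ℝ≥0} {Z : ℕ → ℝ≥0 → Ω → ℕ}

lemma measurable_time (h : IsThinningSetup F P X A Z) :
    Measurable fun ω => (-Real.log (A ω)).toNNReal := by
  have := h.measurable_A
  fun_prop

lemma measurable_thin [IsProbabilityMeasure P] (h : IsThinningSetup F P X A Z) (t : ℝ≥0) :
    Measurable (thin Z A X t) :=
  measurable_randomSum.comp ((h.measurable_X t).prodMk (measurable_pi_lambda _ fun i =>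
    measurable_eval_of_rightCont (h.branching i).measurable (h.branching i).rightCont
      h.measurable_time))

/-- The joint generating function of `A ⊙_F X`, with the factor, the process and the branching
processes integrated out one after the other. -/
lemma integral_multiPow_thin [IsProbabilityMeasure P] (h : IsThinningSetup F P X A Z)
    (I : Finset ℝ≥0) {z : I → ℝ} (hz : ∀ i, z i ∈ Set.Icc (0 : ℝ) 1) :
    ∫ ω, multiPow z (fun t => thin Z A X t ω) ∂P
      = ∫ ω, ∫ ω₁, ∫ ω₂, multiPow z (fun t => ∑ i ∈ Finset.range (X t ω₁),
          Z i (-Real.log (A ω)).toNNReal ω₂) ∂P ∂P ∂P := by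
  have hZ : Measurable fun ω i s => Z i s ω :=
    measurable_pi_lambda _ fun i => measurable_pi_lambda _ fun s => (h.branching i).measurable s
  have hX : Measurable fun ω t => X t ω := measurable_pi_lambda _ h.measurable_X
  have hproj (s : ℝ≥0) : Measurable fun (d : ℕ → ℝ≥0 → ℕ) i => d i s :=
    measurable_pi_lambda _ fun i => (measurable_pi_apply s).comp (measurable_pi_apply i)
  have hres : Measurable fun (x : ℝ≥0 → ℕ) (t : I) => x t :=
    measurable_pi_lambda _ fun t => measurable_pi_apply _
  have hA : IndepFun (fun ω (_ : Unit) => (-Real.log (A ω)).toNNReal)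
      (fun ω => ((fun t => X t ω), fun i s => Z i s ω)) P :=
    h.indep_A.comp (φ := fun (a : ℝ≥0) (_ : Unit) => (-Real.log (a : ℝ)).toNNReal)
      (measurable_pi_lambda _ fun _ => by fun_prop) measurable_id
  set φ : (Unit → ℝ≥0) → (ℝ≥0 → ℕ) × (ℕ → ℝ≥0 → ℕ) → ℝ := fun s d =>
    multiPow z fun t : I => ∑ i ∈ Finset.range (d.1 t), d.2 i (s ()) with hφdef
  have hφ : ∀ s, Measurable (φ s) := fun s =>
    measurable_multiPow_comp z <| measurable_pi_lambda _ fun t => by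
      have hpair : Measurable fun d : (ℝ≥0 → ℕ) × (ℕ → ℝ≥0 → ℕ) =>
          (d.1 t, fun i => d.2 i (s ())) := by fun_prop
      exact measurable_randomSum.comp hpair
  have hφ1 : ∀ s d, φ s d ∈ Set.Icc (0 : ℝ) 1 := fun _ _ => multiPow_mem_Icc hz _
  have hlim : ∀ s ω, Tendsto
      (fun k => φ (fun i => gridAbove k (s i)) ((fun t => X t ω), fun i s => Z i s ω)) atTop
      (𝓝 (φ s ((fun t => X t ω), fun i s => Z i s ω))) := by
    intro s ω
    refine tendsto_nhds_of_eventually_eq ?_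
    have hev : ∀ᶠ k in atTop, ∀ t : I, ∀ i ∈ Finset.range (X t ω),
        Z i (gridAbove k (s ())) ω = Z i (s ()) ω :=
      eventually_all.2 fun t => (Finset.eventually_all _).2 fun i _ =>
        eventually_eq_gridAbove ((h.branching i).rightCont ω _)
    filter_upwards [hev] with k hk
    exact congrArg (multiPow z) (funext fun t => Finset.sum_congr rfl (hk t))
  have h1 := integral_comp_eq_integral_integral_of_gridAbove
    (measurable_pi_lambda _ fun _ => h.measurable_time) (hX.prodMk hZ) hA hφ hφ1 hlim
  have h2 (s : ℝ≥0) := integral_comp_eq_integral_integral_of_indepFun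
    (φ := fun p : (I → ℕ) × (ℕ → ℕ) => multiPow z fun t => ∑ i ∈ Finset.range (p.1 t), p.2 i)
    (hres.comp hX) ((hproj s).comp hZ) (h.indep_X.comp hres (hproj s))
    (measurable_multiPow_randomSum z) fun _ => multiPow_mem_Icc hz _
  simp only [hφdef] at h1
  simp only [Function.comp_def] at h2
  simp only [h2] at h1
  exact h1

end IsThinningSetup

theorem theorem1 {Ω : Type u} [MeasurableSpace Ω] (P : Measure Ω) [IsProbabilityMeasure P]
    (F : ℝ≥0 → ℝ → ℝ) (hF : IsPGFSemigroup F)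
    (G : ℝ → ℝ) (hG : IsPGF G) (hFG : IsRelated F G)
    (Y : ℝ≥0 → Ω → ℝ≥0) (T : ℝ≥0) (hT : 0 < T) (m : ℝ≥0 → Measure ℝ≥0)
    (hYmono : ∀ᵐ ω ∂P, Monotone (fun t => Y t ω))
    (hY : IsMultifractalWith P Y T m)
    (hm : ∀ l : ℝ≥0, 0 < l → l < 1 → m l (Set.Ioo 0 1) = 1)
    (N : ℝ≥0 → Ω → ℕ) (hN : IsCompoundPoisson G P N)
    (hNY : IndepFun (fun ω t => N t ω) (fun ω t => Y t ω) P) :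
    IsFMultifractalWith.{u, v} F P (fun t ω => N (Y t ω) ω) T m ∧
      IsFMultifractal.{u, v} F P (fun t ω => N (Y t ω) ω) := by
  have hYm := hY.1
  have hX : ∀ t, Measurable fun ω => N (Y t ω) ω := fun t =>
    measurable_eval_of_rightCont hN.measurable hN.rightCont (hYm t)
  suffices h : IsFMultifractalWith.{u, v} F P (fun t ω => N (Y t ω) ω) T m from ⟨h, T, hT, m, h⟩
  refine ⟨hX, fun l hl0 hl1 => ⟨(hY.2 l hl0 hl1).1, hm l hl0 hl1, ?_⟩⟩
  intro Ω' _ P' _ X' A Z hS hA hXX' I hI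
  have := (hY.2 l hl0 hl1).1
  have hYI (c : ℝ≥0) : Measurable fun ω (t : I) => Y (c * t) ω :=
    measurable_pi_lambda _ fun t => hYm _
  have hind (c : ℝ≥0) : IndepFun (fun ω (t : I) => Y (c * t) ω) (fun ω t => N t ω) P :=
    hNY.symm.comp (φ := fun (y : ℝ≥0 → ℝ≥0) (t : I) => y (c * t))
      (measurable_pi_lambda _ fun t => measurable_pi_apply _) measurable_id
  have hXl : Measurable fun ω (t : I) => N (Y (l * t) ω) ω := measurable_pi_lambda _ fun t => hX _
  have hthin : Measurable fun ω (t : I) => thin Z A X' t ω :=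
    measurable_pi_lambda _ fun t => hS.measurable_thin t
  have := Measure.isProbabilityMeasure_map (μ := P) hXl.aemeasurable
  have := Measure.isProbabilityMeasure_map (μ := P') hthin.aemeasurable
  refine ⟨hXl.aemeasurable, hthin.aemeasurable, measure_ext_of_multiPow fun z hz => ?_⟩
  have hmeas : AEStronglyMeasurable (multiPow z) (P'.map fun ω (t : I) => thin Z A X' t ω) :=
    (measurable_of_countable _).aestronglyMeasurable
  rw [integral_map hXl.aemeasurable (measurable_of_countable _).aestronglyMeasurable,
    integral_map hthin.aemeasurable hmeas, hS.integral_multiPow_thin I hz]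
  -- `Φ y` is the joint generating function of `N` at the deterministic times `y`.
  set Φ : (I → ℝ≥0) → ℝ := fun y => ∫ ω, multiPow z (fun t => N (y t) ω) ∂P
  have hΦm : Measurable Φ :=
    measurable_integral_eval hN.measurable hN.rightCont fun n => multiPow_mem_Icc hz n
  have hΦ1 : ∀ y, Φ y ∈ Set.Icc (0 : ℝ) 1 := fun y => integral_mem_Icc fun _ => multiPow_mem_Icc hz _
  have hprod : Measurable fun p : ℝ≥0 × Ω => fun t : I => p.1 * Y t p.2 :=
    measurable_pi_lambda _ fun t => measurable_fst.mul ((hYm t).comp measurable_snd)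
  have hinner : ∀ᵐ ω' ∂P', (∫ ω₁, ∫ ω₂, multiPow z (fun t => ∑ i ∈ Finset.range (X' t ω₁),
      Z i (-Real.log (A ω')).toNNReal ω₂) ∂P' ∂P') = ∫ ω, Φ (fun t => A ω' * Y t ω) ∂P := by
    filter_upwards [hS.mem_Ioo] with ω' ha
    set s := (-Real.log (A ω')).toNNReal with hs
    have hlog : Real.log (A ω') < 0 :=
      Real.log_neg (NNReal.coe_pos.2 ha.1) (by exact_mod_cast ha.2)
    have hs0 : 0 < s := Real.toNNReal_pos.2 (neg_pos.2 hlog)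
    have hexp : Real.exp (-(s : ℝ)) = A ω' := by
      rw [hs, Real.coe_toNNReal _ (neg_pos.2 hlog).le, neg_neg,
        Real.exp_log (NNReal.coe_pos.2 ha.1)]
    have hf : ∀ i, ∀ w ∈ Set.Icc (0 : ℝ) 1, ∫ ω, w ^ Z i s ω ∂P' = F s w := fun i w hw => by
      rw [integral_pow_eq_pgf ((hS.branching i).measurable s) hw,
        (hS.branching i).pgf_eq s w (abs_le.2 ⟨by linarith [hw.1], hw.2⟩)]
    have hZi : iIndepFun (fun i => Z i s) P' :=
      hS.indep_Z.comp (fun _ x => x s) fun _ => measurable_pi_apply s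
    -- `ψ n` depends on the counts only, so that `X'` may be replaced with its copy `N ∘ Y`.
    set ψ : (I → ℕ) → ℝ := fun n => ∫ ω₂, multiPow z (fun t => ∑ i ∈ Finset.range (n t),
      Z i s ω₂) ∂P'
    have hψ1 : ∀ n, ψ n ∈ Set.Icc (0 : ℝ) 1 := fun n =>
      integral_mem_Icc fun _ => multiPow_mem_Icc hz _
    have h1 := ((hXX' I (Set.subset_univ _)).comp (measurable_of_countable ψ)).integral_eq
    have h2 := integral_eval_eq_integral_integral (h := ψ) hN.measurable hN.rightCont
      (hYI 1) (hind 1) hψ1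
    simp only [one_mul] at h2
    refine h1.symm.trans (h2.trans (integral_congr_ae (ae_of_all _ fun ω => ?_)))
    refine integral_multiPow_thinning_compoundPoisson hN (fun i => (hS.branching i).measurable s)
      hZi hf (fun w hw => ?_) (fun t : I => Y t ω) hz
    rw [← hexp]
    exact hFG.2 s hs0 w hw.1 hw.2
  have h3 := ((hY.2 l hl0 hl1).2.2 I hI).comp hΦm |>.integral_eq
  rw [integral_congr_ae hinner,
    integral_eval_eq_integral_integral hN.measurable hN.rightCont (hYI l) (hind l)
      fun n => multiPow_mem_Icc hz n]
  refine h3.trans ?_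
  rw [integral_prod _ (integrable_of_mem_Icc (hΦm.comp hprod).aestronglyMeasurable
    fun _ => hΦ1 _), ← hA.map_eq, integral_map hS.measurable_A.aemeasurable]
  · rfl
  · exact ((hΦm.comp hprod).stronglyMeasurable.integral_prod_right' (ν := P)).aestronglyMeasurable
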